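/- There is an absolute constant $C$ such that the following holds for all integers $n\ge 1$ and all real $i\ge 0$ for which $m=\lfloor 2^i n\log n\rfloor$ (natural logarithm) is at most $\binom n2$. Let $G=G(n,m)$ be a uniformly random simple graph with $n$ labelled vertices and $m$ edges, let $r$ be any fixed vertex, and run a depth-first search of $G$ from $r$. The next vertex is selected among the unvisited neighbours of the current vertex by an arbitrary fixed rule that may depend on the order in which vertices were visited so far and on the edges with at least one visited endpoint, but not on the edges between unvisited vertices (for instance, by scanning adjacency lists in an order fixed independently of $G$). Then, with probability at least $1-C/n$, the DFS tree rooted at $r$ is a spanning tree of $G$ and is a "broomstick": starting at $r$ it has a downward path (the stick), each vertex of which has exactly one child in the tree, of length (number of edges) at least $n-n/2^i$, and the bristles, that is, the vertices that are not on the stick, number at most $n/2^i$. -/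

import Mathlib

open MeasureTheory ProbabilityTheory

/-- The random graph `G(n,m)`: the uniform distribution on the simple graphs with vertex set
`Fin n` and exactly `m` edges. -/
noncomputable def gnm (n m : ℕ) : Measure (SimpleGraph (Fin n)) :=
  uniformOn {G : SimpleGraph (Fin n) | G.edgeSet.ncard = m}

namespace DFS

variable {V : Type*}

/-- The part of `G` that a traversal has read once the vertices in `visited` have been visited:
all the edges with at least one endpoint in `visited`. -/
def exposed (G : SimpleGraph V) (visited : List V) : SimpleGraph V where
  Adj u w := G.Adj u w ∧ (u ∈ visited ∨ w ∈ visited)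
  symm := ⟨fun _ _ h => ⟨h.1.symm, h.2.symm⟩⟩
  loopless := ⟨fun v h => G.loopless.irrefl v h.1⟩

/-- A rule by which a depth-first search selects the next vertex. When the current vertex `v` has
an unvisited neighbour, `next H visited v` is one of the unvisited neighbours of `v`. Here `visited`
lists the visited vertices, the latest first, and `H` is the part of the graph read so far; the rule
cannot look at the edges between unvisited vertices. Scanning adjacency lists in a prescribed order
is the special case in which the choice is the first unvisited entry of the list of `v`. -/
structure Rule (V : Type*) where
  next : SimpleGraph V → List V → V → V
  next_spec : ∀ (H : SimpleGraph V) (visited : List V) (v : V),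
    (∃ w, H.Adj v w ∧ w ∉ visited) → H.Adj v (next H visited v) ∧ next H visited v ∉ visited

/-- A state of a depth-first search. -/
structure State (V : Type*) where
  /-- The tree path from the current vertex (the head) up to the root. -/
  stack : List V
  /-- The visited vertices, the latest first. -/
  visited : List V
  /-- The parent of each visited vertex other than the root in the tree built so far. -/
  parent : V → Option V

/-- The initial state of a depth-first search from `r`. -/
def init (r : V) : State V where
  stack := [r]
  visited := [r]
  parent := fun _ => none

open Classical in
/-- One step of depth-first search: move from the current vertex `v` to an unvisited neighbour of
`v`, which becomes a child of `v`, or, if there is none, backtrack. -/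
noncomputable def step (G : SimpleGraph V) (ρ : Rule V) (s : State V) : State V :=
  match s.stack with
  | [] => s
  | v :: rest =>
    if ∃ w, G.Adj v w ∧ w ∉ s.visited then
      let w := ρ.next (exposed G s.visited) s.visited v
      { stack := w :: v :: rest
        visited := w :: s.visited
        parent := Function.update s.parent w (some v) }
    else
      { stack := rest
        visited := s.visited
        parent := s.parent }

/-- The final state of the depth-first search of `G` from `r`. Every vertex is pushed and popped at
most once, so that the stack is empty after at most `2 * Fintype.card V` steps, and then the state
no longer changes. -/
noncomputable def final [Fintype V] (G : SimpleGraph V) (ρ : Rule V) (r : V) : State V :=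
  (step G ρ)^[2 * Fintype.card V] (init r)

/-- The DFS tree of `G` from the root `r`, given by its parent pointers. -/
noncomputable def treeParent [Fintype V] (G : SimpleGraph V) (ρ : Rule V) (r : V) :
    V → Option V :=
  (final G ρ r).parent

/-- The DFS tree of `G` from `r` spans `G`: each vertex other than the root has a parent. -/
def Spans [Fintype V] (G : SimpleGraph V) (ρ : Rule V) (r : V) : Prop :=
  ∀ v, v ≠ r → ∃ u, treeParent G ρ r v = some u

/-- `x 0, …, x L` is a stick, of length `L`, of the rooted tree with root `r` and parent function
`parent`: a downward path from the root such that each vertex on it has exactly one child. -/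
structure IsStick (parent : V → Option V) (r : V) (L : ℕ) (x : Fin (L + 1) → V) : Prop where
  root : x 0 = r
  down : ∀ j : Fin L, parent (x j.succ) = some (x j.castSucc)
  unbranched : ∀ j : Fin (L + 1), ∃! w, parent w = some (x j)

/-- The DFS tree of `G` from `r` is spanning and is a broomstick: it has a stick of length at least
`ℓ`, and the bristles, the vertices that are not on the stick, are at most `b` in number. -/
def IsBroomstick [Fintype V] (G : SimpleGraph V) (ρ : Rule V) (r : V) (ℓ b : ℝ) : Prop :=
  Spans G ρ r ∧
    ∃ (L : ℕ) (x : Fin (L + 1) → V), IsStick (treeParent G ρ r) r L x ∧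
      ℓ ≤ (L : ℝ) ∧ ((Set.range x)ᶜ.ncard : ℝ) ≤ b

end DFS

/-! Follow a greedy walk from `r` that obeys the search rule and, at a dead end, jumps to any
unvisited vertex. Put `w = ⌊n / 2 ^ i⌋₊ - 1` and `L = n - w - 1`. If none of the vertices `0, …, L`
of the walk is a dead end, the walk agrees with the depth-first search through step `L + 1`. If
moreover the `w` vertices outside the first `L + 1` induce a connected graph, the search exhausts
them below vertex `L` before backtracking to it, and the tree is a broomstick
(`isBroomstick_of_walk`).

Each failure is an empty cut: no edge joins two disjoint vertex sets chosen by the walk, between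
which no pair has been read. Deferred decisions (`card_avoiding`) count such graphs exactly as if
the `k` forbidden pairs were fixed in advance, so a failure has probability at most `exp (-q * k)`,
with `q` the edge density (`gnm_real_le`). A dead end forbids at least `w` pairs and has probability
`O(1/n^2)`. A set of `s` of the `w` vertices is cut off by `s * (w - s)` pairs, and these bounds sum
to `O(1/n)` over `1 ≤ s ≤ w / 2` (`sum_cuts_le`). -/

/-! ### Deferred decisions for uniform `m`-subsets. -/

section Deferred

variable {α : Type*} [DecidableEq α]

/-- Let `D A` be a set of `k` points of `Ω` that depends only on the part of `A` outside `D A`.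
Then the generating function of the sets that avoid their `D A` is `(1 + X) ^ (#Ω - k)`. -/
theorem sum_X_pow_card_avoiding (Ω : Finset α) (D : Finset α → Finset α) (k : ℕ)
    (hsub : ∀ A, D A ⊆ Ω) (hcard : ∀ A, (D A).card = k)
    (hdef : ∀ A B, A \ D A = B \ D A → D A = D B) :
    ∑ A ∈ Ω.powerset with Disjoint A (D A), (Polynomial.X : Polynomial ℤ) ^ A.card =
      (1 + Polynomial.X) ^ (Ω.card - k) := by
  have hk : k ≤ Ω.card := by rw [← hcard ∅]; exact Finset.card_le_card (hsub ∅)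
  have hpow : ∀ s : Finset α, ∑ B ∈ s.powerset, (Polynomial.X : Polynomial ℤ) ^ B.card =
      (1 + Polynomial.X) ^ s.card := by
    intro s
    rw [add_comm, ← Finset.sum_pow_mul_eq_add_pow]
    simp
  have hD : ∀ A, D (A \ D A) = D A := fun A ↦ (hdef A (A \ D A) (by simp)).symm
  -- Each `A` is uniquely `H ∪ B` with `H` disjoint from `D H` and `B ⊆ D H`, namely `H = A \ D A`.
  -- Hence `(1 + X) ^ #Ω` is the wanted sum times `(1 + X) ^ k`, which can be cancelled.
  have key : ∑ A ∈ Ω.powerset, (Polynomial.X : Polynomial ℤ) ^ A.card =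
      ∑ H ∈ Ω.powerset with Disjoint H (D H), ∑ B ∈ (D H).powerset,
        (Polynomial.X : Polynomial ℤ) ^ H.card * Polynomial.X ^ B.card := by
    rw [Finset.sum_sigma']
    refine Finset.sum_bij' (fun A _ ↦ ⟨A \ D A, A ∩ D A⟩) (fun p _ ↦ p.1 ∪ p.2) ?_ ?_ ?_ ?_ ?_
    · intro A hA
      simp only [Finset.mem_sigma, Finset.mem_filter, Finset.mem_powerset, hD] at hA ⊢
      exact ⟨⟨Finset.sdiff_subset.trans hA, Finset.sdiff_disjoint⟩, Finset.inter_subset_right⟩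
    · rintro ⟨H, B⟩ h
      simp only [Finset.mem_sigma, Finset.mem_filter, Finset.mem_powerset] at h ⊢
      exact Finset.union_subset h.1.1 (h.2.trans (hsub H))
    · intro A _
      exact Finset.sdiff_union_inter A (D A)
    · rintro ⟨H, B⟩ h
      simp only [Finset.mem_sigma, Finset.mem_filter, Finset.mem_powerset] at h
      obtain ⟨⟨_, h2⟩, h3⟩ := h
      have e : D (H ∪ B) = D H := by
        refine (hdef H (H ∪ B) ?_).symm
        rw [Finset.union_sdiff_distrib, Finset.sdiff_eq_empty_iff_subset.2 h3, Finset.union_empty]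
      have e1 : (H ∪ B) \ D H = H := by
        rw [Finset.union_sdiff_distrib, Finset.sdiff_eq_empty_iff_subset.2 h3, Finset.union_empty,
          Finset.sdiff_eq_self_of_disjoint h2]
      have e2 : (H ∪ B) ∩ D H = B := by
        rw [Finset.union_inter_distrib_right, Finset.disjoint_iff_inter_eq_empty.1 h2,
          Finset.empty_union, Finset.inter_eq_left.2 h3]
      simp only [e, e1, e2]
    · intro A _
      rw [← pow_add, Finset.card_sdiff_add_card_inter]
  simp_rw [← Finset.mul_sum, hpow, hcard, ← Finset.sum_mul] at key
  have hne : (1 + Polynomial.X : Polynomial ℤ) ^ k ≠ 0 := by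
    refine pow_ne_zero _ fun h ↦ ?_
    simpa using congrArg (Polynomial.eval 0) h
  refine mul_right_cancel₀ hne ?_
  rw [← key, ← pow_add, Nat.sub_add_cancel hk]

/-- The number of `m`-subsets of `Ω` that avoid a set of `k` deferred points. -/
theorem card_avoiding (Ω : Finset α) (D : Finset α → Finset α) (k m : ℕ)
    (hsub : ∀ A, D A ⊆ Ω) (hcard : ∀ A, (D A).card = k)
    (hdef : ∀ A B, A \ D A = B \ D A → D A = D B) :
    ((Ω.powersetCard m).filter fun A ↦ Disjoint A (D A)).card = (Ω.card - k).choose m := by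
  have h := congrArg (fun p ↦ Polynomial.coeff p m)
    (sum_X_pow_card_avoiding Ω D k hsub hcard hdef)
  simp only [Polynomial.coeff_one_add_X_pow, Polynomial.finsetSum_coeff,
    Polynomial.coeff_X_pow] at h
  rw [Finset.sum_boole, Finset.filter_filter] at h
  have h' : ((Ω.powersetCard m).filter fun A ↦ Disjoint A (D A)) =
      Ω.powerset.filter fun A ↦ Disjoint A (D A) ∧ m = A.card := by
    ext A
    simp only [Finset.mem_filter, Finset.mem_powersetCard, Finset.mem_powerset]
    tauto
  rw [h']
  exact_mod_cast h

end Deferred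

theorem choose_sub_le_exp_mul_choose (N k m : ℕ) :
    ((N - k).choose m : ℝ) ≤ Real.exp (-((m : ℝ) / N * k)) * N.choose m := by
  rcases lt_or_ge N k with hk | hk
  · rcases Nat.eq_zero_or_pos m with rfl | hm
    · simp
    · rw [Nat.sub_eq_zero_of_le hk.le, Nat.choose_eq_zero_of_lt hm]
      simp only [Nat.cast_zero]
      positivity
  induction k with
  | zero => simp
  | succ k ih =>
    have ih := ih (by omega)
    obtain ⟨M, hM⟩ : ∃ M, N - k = M + 1 := ⟨N - k - 1, by omega⟩
    have hM' : N - (k + 1) = M := by omega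
    rw [hM] at ih
    rw [hM']
    have hN : (0 : ℝ) < N := by exact_mod_cast (by omega : 0 < N)
    have hMN : (M : ℝ) + 1 ≤ N := by exact_mod_cast (by omega : M + 1 ≤ N)
    -- The ratio of the two binomials is exactly `1 - m / (M + 1)`, and `M + 1 ≤ N`.
    have step : (M.choose m : ℝ) ≤ (1 - (m : ℝ) / N) * (M + 1).choose m := by
      rcases le_or_gt m (M + 1) with h | h
      · have e := Nat.choose_mul_succ_eq M m
        have e' : (M.choose m : ℝ) * (M + 1) = (M + 1).choose m * (M + 1 - m) := by
          have := congrArg (Nat.cast : ℕ → ℝ) e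
          push_cast [Nat.cast_sub h] at this
          exact this
        have e2 : (M.choose m : ℝ) = (M + 1).choose m * (1 - m / (M + 1)) := by
          field_simp
          linarith
        rw [e2, mul_comm]
        gcongr
      · rw [Nat.choose_eq_zero_of_lt (by omega), Nat.choose_eq_zero_of_lt h]
        simp
    have hexp : 1 - (m : ℝ) / N ≤ Real.exp (-((m : ℝ) / N)) := by
      have := Real.add_one_le_exp (-((m : ℝ) / N))
      linarith
    calc (M.choose m : ℝ) ≤ (1 - (m : ℝ) / N) * (M + 1).choose m := step
      _ ≤ Real.exp (-((m : ℝ) / N)) * (Real.exp (-((m : ℝ) / N * k)) * N.choose m) := by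
        refine mul_le_mul hexp ih (by positivity) (by positivity)
      _ = _ := by
        rw [← mul_assoc, ← Real.exp_add]
        push_cast
        ring_nf

/-- Makes every set of graphs on a finite vertex set measurable, so that `uniformOn` is a ratio of
counts. -/
instance measurableSingletonClass_simpleGraph {V : Type*} [Finite V] :
    MeasurableSingletonClass (SimpleGraph V) where
  measurableSet_singleton G := by
    have h : ({G} : Set (SimpleGraph V)) =
        SimpleGraph.Adj ⁻¹' {G.Adj} := by
      ext H
      exact SimpleGraph.adj_inj.symm
    rw [h]
    exact ⟨_, measurableSet_singleton _, rfl⟩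

/-! ### The greedy walk and the edges it reads. -/

namespace DFS

variable {V : Type*}

open Classical in
/-- The vertex that the greedy walk visits after the vertices in `l`: the one that the rule selects
if the latest vertex has an unvisited neighbour, and otherwise an arbitrary unvisited one. -/
noncomputable def nextVertex (G : SimpleGraph V) (ρ : Rule V) (r : V) (l : List V) : V :=
  if ∃ w, G.Adj (l.headD r) w ∧ w ∉ l then ρ.next (exposed G l) l (l.headD r)
  else if h : ∃ w, w ∉ l then h.choose else r

/-- The vertices visited by the first `d` steps of the greedy walk from `r`, the latest first. -/
noncomputable def walk (G : SimpleGraph V) (ρ : Rule V) (r : V) : ℕ → List V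
  | 0 => [r]
  | d + 1 => nextVertex G ρ r (walk G ρ r d) :: walk G ρ r d

variable (G : SimpleGraph V) (ρ : Rule V) (r : V)

@[simp] theorem length_walk (d : ℕ) : (walk G ρ r d).length = d + 1 := by
  induction d with
  | zero => rfl
  | succ d ih => simp [walk, ih]

theorem walk_eq_cons (d : ℕ) :
    walk G ρ r d = (walk G ρ r d).headD r :: (walk G ρ r d).tail := by
  cases d <;> rfl

theorem headD_mem_walk (d : ℕ) : (walk G ρ r d).headD r ∈ walk G ρ r d := by
  cases d <;> simp [walk]

theorem walk_subset_walk {d e : ℕ} (h : d ≤ e) : walk G ρ r d ⊆ walk G ρ r e := by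
  induction h with
  | refl => exact List.Subset.refl _
  | step _ ih => exact fun v hv ↦ List.mem_cons_of_mem _ (ih hv)

theorem walk_subset_tail {d e : ℕ} (h : d < e) : walk G ρ r d ⊆ (walk G ρ r e).tail := by
  obtain ⟨e, rfl⟩ : ∃ k, e = k + 1 := ⟨e - 1, by omega⟩
  exact walk_subset_walk G ρ r (by omega)

variable {G ρ r}

theorem exposed_adj_next {l : List V} {v : V} (h : ∃ w, G.Adj v w ∧ w ∉ l) (hv : v ∈ l) :
    G.Adj v (ρ.next (exposed G l) l v) ∧ ρ.next (exposed G l) l v ∉ l := by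
  obtain ⟨w, hw, hwl⟩ := h
  obtain ⟨h1, h2⟩ := ρ.next_spec (exposed G l) l v ⟨w, ⟨hw, Or.inl hv⟩, hwl⟩
  exact ⟨h1.1, h2⟩

theorem nextVertex_notMem {l : List V} (hl : l.headD r ∈ l) (h : ∃ w, w ∉ l) :
    nextVertex G ρ r l ∉ l := by
  unfold nextVertex
  split_ifs with h1
  · exact (exposed_adj_next h1 hl).2
  · exact h.choose_spec

/-- The jumps at dead ends make this true for every `G`; hence the number of unvisited vertices
after `d` steps does not depend on the graph, as `card_avoiding` requires. -/
theorem nodup_walk [Fintype V] {d : ℕ} (hd : d < Fintype.card V) : (walk G ρ r d).Nodup := by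
  classical
  induction d with
  | zero => simp [walk]
  | succ d ih =>
    refine List.nodup_cons.2 ⟨nextVertex_notMem (headD_mem_walk G ρ r d) ?_, ih (by omega)⟩
    by_contra! hall
    have h1 : (walk G ρ r d).toFinset = Finset.univ := by
      ext w; simp [hall w]
    have h2 := List.toFinset_card_le (walk G ρ r d)
    rw [h1, Finset.card_univ, length_walk] at h2
    omega

/-- The walk is determined by the edges that it has read. -/
theorem walk_congr {G' : SimpleGraph V} {d : ℕ}
    (h : ∀ e < d, ∀ u ∈ walk G ρ r e, ∀ v, G.Adj u v ↔ G'.Adj u v) :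
    walk G ρ r d = walk G' ρ r d := by
  induction d with
  | zero => rfl
  | succ d ih =>
    have e1 := ih fun e he ↦ h e (by omega)
    have hadj := h d (by omega)
    have e2 : exposed G (walk G ρ r d) = exposed G' (walk G ρ r d) := by
      ext u v
      simp only [exposed]
      refine and_congr_left ?_
      rintro (hu | hv)
      · exact hadj u hu v
      · rw [G.adj_comm, G'.adj_comm]; exact hadj v hv u
    have e3 : ∀ w, G.Adj ((walk G ρ r d).headD r) w ↔ G'.Adj ((walk G ρ r d).headD r) w :=
      hadj _ (headD_mem_walk G ρ r d)
    simp only [walk]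
    rw [← e1]
    congr 1
    unfold nextVertex
    rw [e2]
    congr 1
    simp only [e3]

end DFS

/-! ### Counting graphs with an empty cut chosen by the walk. -/

section Cut

variable {V : Type*} [DecidableEq V]

/-- The pairs of a vertex of `T` and a vertex of `U`. -/
def cutPairs (T U : Finset V) : Finset (Sym2 V) := (T ×ˢ U).image fun p ↦ s(p.1, p.2)

theorem mk_mem_cutPairs {T U : Finset V} {a b : V} :
    s(a, b) ∈ cutPairs T U ↔ a ∈ T ∧ b ∈ U ∨ b ∈ T ∧ a ∈ U := by
  simp only [cutPairs, Finset.mem_image, Finset.mem_product, Prod.exists, Sym2.eq_iff]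
  constructor
  · rintro ⟨x, y, ⟨hx, hy⟩, ⟨rfl, rfl⟩ | ⟨rfl, rfl⟩⟩
    · exact Or.inl ⟨hx, hy⟩
    · exact Or.inr ⟨hx, hy⟩
  · rintro (⟨h1, h2⟩ | ⟨h1, h2⟩)
    · exact ⟨a, b, ⟨h1, h2⟩, Or.inl ⟨rfl, rfl⟩⟩
    · exact ⟨b, a, ⟨h1, h2⟩, Or.inr ⟨rfl, rfl⟩⟩

theorem card_cutPairs {T U : Finset V} (h : Disjoint T U) :
    (cutPairs T U).card = T.card * U.card := by
  rw [cutPairs, Finset.card_image_of_injOn, Finset.card_product]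
  rintro ⟨a, b⟩ hab ⟨c, d⟩ hcd e
  simp only [Finset.coe_product, Set.mem_prod, Finset.mem_coe] at hab hcd
  simp only [Sym2.eq_iff] at e
  rcases e with ⟨rfl, rfl⟩ | ⟨rfl, rfl⟩
  · rfl
  · exact absurd hcd.2 (Finset.disjoint_left.1 h hab.1)

open Classical in
/-- The graphs on `V` with `m` edges such that no edge joins `T` and `U`, two disjoint sets of
sizes `t` and `u` that are chosen after `d` steps of the greedy walk among the vertices whose
edges have not been read. -/
theorem card_no_cut_edge_le [Fintype V] (ρ : DFS.Rule V) (r : V) (d m t u : ℕ) (hd : d < Fintype.card V)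
    (T U : List V → Finset V)
    (hTU : ∀ l : List V, l ≠ [] → l.Nodup → l.length = d + 1 → Disjoint (T l) (U l) ∧
      (T l).card = t ∧ (U l).card = u ∧ ∀ v ∈ l.tail, v ∉ T l ∧ v ∉ U l) :
    (Finset.univ.filter fun G : SimpleGraph V ↦ G.edgeSet.ncard = m ∧
      ∀ a ∈ T (DFS.walk G ρ r d), ∀ b ∈ U (DFS.walk G ρ r d), ¬ G.Adj a b).card ≤
      ((Fintype.card V).choose 2 - t * u).choose m := by
  have hwalk : ∀ G : SimpleGraph V, _ := fun G ↦ hTU (DFS.walk G ρ r d)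
    (by rw [DFS.walk_eq_cons]; simp) (DFS.nodup_walk hd) (DFS.length_walk G ρ r d)
  let gr : Finset (Sym2 V) → SimpleGraph V := fun A ↦ SimpleGraph.fromEdgeSet (A : Set (Sym2 V))
  let D : Finset (Sym2 V) → Finset (Sym2 V) := fun A ↦
    cutPairs (T (DFS.walk (gr A) ρ r d)) (U (DFS.walk (gr A) ρ r d))
  have hΩ : (Finset.univ.filter fun e : Sym2 V ↦ ¬ e.IsDiag).card =
      (Fintype.card V).choose 2 := by
    rw [← SimpleGraph.card_edgeFinset_top_eq_card_choose_two]
    congr 1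
    ext e
    simp
  rw [← hΩ, ← card_avoiding (Finset.univ.filter fun e : Sym2 V ↦ ¬ e.IsDiag) D (t * u) m]
  · refine Finset.card_le_card_of_injOn (fun G ↦ G.edgeFinset) ?_ ?_
    · intro G hG
      simp only [Finset.coe_filter, Finset.mem_univ, true_and, Set.mem_ofPred_eq] at hG
      obtain ⟨hm, hno⟩ := hG
      have hgr : gr G.edgeFinset = G := by simp [gr]
      simp only [Finset.coe_filter, Finset.mem_powersetCard, Set.mem_ofPred_eq]
      refine ⟨⟨fun e he ↦ ?_, ?_⟩, ?_⟩
      · simp only [Finset.mem_filter, Finset.mem_univ, true_and]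
        exact G.not_isDiag_of_mem_edgeFinset he
      · rw [← hm, ← SimpleGraph.coe_edgeFinset, Set.ncard_coe_finset]
      · rw [Finset.disjoint_left]
        intro e
        induction e with
        | _ a b =>
          intro he hD
          rw [SimpleGraph.mem_edgeFinset, SimpleGraph.mem_edgeSet] at he
          simp only [D, hgr] at hD
          rcases mk_mem_cutPairs.1 hD with ⟨ha, hb⟩ | ⟨hb, ha⟩
          · exact hno a ha b hb he
          · exact hno b hb a ha he.symm
    · intro G _ G' _ h
      exact SimpleGraph.edgeFinset_inj.1 h
  · intro A e
    induction e with
    | _ a b =>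
      intro he
      simp only [Finset.mem_filter, Finset.mem_univ, true_and, Sym2.mk_isDiag_iff]
      rintro rfl
      have hdis := (hwalk (gr A)).1
      rcases mk_mem_cutPairs.1 he with ⟨ha, hb⟩ | ⟨ha, hb⟩
      · exact Finset.disjoint_left.1 hdis ha hb
      · exact Finset.disjoint_left.1 hdis ha hb
  · intro A
    obtain ⟨h1, h2, h3, _⟩ := hwalk (gr A)
    simp only [D]
    rw [card_cutPairs h1, h2, h3]
  · intro A B hAB
    -- The first `d` steps read only pairs that meet the tail of the walk. These lie outside `D A`,
    -- where `A` and `B` agree.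
    have : DFS.walk (gr A) ρ r d = DFS.walk (gr B) ρ r d := by
      refine DFS.walk_congr fun e he x hx y ↦ ?_
      have hout := (hwalk (gr A)).2.2.2 x (DFS.walk_subset_tail _ ρ r he hx)
      have hxy : s(x, y) ∉ D A := by
        intro h
        rcases mk_mem_cutPairs.1 h with ⟨h, _⟩ | ⟨_, h⟩
        · exact hout.1 h
        · exact hout.2 h
      have := congrArg (fun S ↦ s(x, y) ∈ S) hAB
      simp only [Finset.mem_sdiff, hxy, not_false_eq_true, and_true, eq_iff_iff] at this
      simp [gr, this]
    simp only [D, this]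

end Cut

/-! ### Termination of the search. -/

namespace DFS

section Termination

variable {V : Type*} {G : SimpleGraph V} {ρ : Rule V}

theorem step_push {s : State V} {v : V} {rest : List V} (hs : s.stack = v :: rest)
    (h : ∃ w, G.Adj v w ∧ w ∉ s.visited) (hv : v ∈ s.visited) :
    ∃ w, w ∉ s.visited ∧ G.Adj v w ∧ w = ρ.next (exposed G s.visited) s.visited v ∧
      (step G ρ s).stack = w :: v :: rest ∧
      (step G ρ s).visited = w :: s.visited ∧
      ∀ x y, (step G ρ s).parent x = some y ↔ (x = w ∧ y = v) ∨ (x ≠ w ∧ s.parent x = some y) := by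
  classical
  obtain ⟨h1, h2⟩ := exposed_adj_next (ρ := ρ) h hv
  refine ⟨_, h2, h1, rfl, ?_, ?_, ?_⟩
  · simp only [step, hs, if_pos h]
  · simp only [step, hs, if_pos h]
  · intro x y
    simp only [step, hs, if_pos h, Function.update_apply]
    split_ifs with hx
    · simp [hx, eq_comm]
    · simp [hx]

theorem step_pop {s : State V} {v : V} {rest : List V} (hs : s.stack = v :: rest)
    (h : ¬ ∃ w, G.Adj v w ∧ w ∉ s.visited) :
    step G ρ s = ⟨rest, s.visited, s.parent⟩ := by
  simp only [step, hs, if_neg h]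

theorem step_nil {s : State V} (hs : s.stack = []) : step G ρ s = s := by
  simp only [step, hs]

theorem stack_subset_visited_step {s : State V} (h : s.stack ⊆ s.visited) :
    (step G ρ s).stack ⊆ (step G ρ s).visited := by
  rcases hs : s.stack with _ | ⟨v, rest⟩
  · rw [step_nil hs]; exact h
  · by_cases hw : ∃ w, G.Adj v w ∧ w ∉ s.visited
    · obtain ⟨w, _, _, _, h1, h2, _⟩ := step_push (ρ := ρ) hs hw (h (by simp [hs]))
      rw [h1, h2, ← hs]
      exact List.cons_subset_cons w h
    · rw [step_pop hs hw]
      exact fun x hx ↦ h (by simp [hs, hx])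

variable [Fintype V]

/-- A push lowers twice the number of unvisited vertices by 2 and lengthens the stack by 1; a pop
shortens the stack by 1. Either way the potential pays for the step. -/
theorem stack_eq_nil_or_potential_le (r : V) (k : ℕ) :
    ((step G ρ)^[k] (init r)).stack ⊆ ((step G ρ)^[k] (init r)).visited ∧
    (((step G ρ)^[k] (init r)).stack = [] ∨
      2 * {v | v ∉ ((step G ρ)^[k] (init r)).visited}.ncard +
        ((step G ρ)^[k] (init r)).stack.length + k + 1 ≤ 2 * Fintype.card V) := by
  induction k with
  | zero =>
    refine ⟨fun x hx ↦ hx, Or.inr ?_⟩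
    have h := Set.ncard_add_ncard_compl {r}
    rw [Set.ncard_singleton, Nat.card_eq_fintype_card] at h
    have e : {v | v ∉ [r]} = ({r} : Set V)ᶜ := by ext; simp
    simp only [Function.iterate_zero, id, init, e, List.length_singleton]
    omega
  | succ k ih =>
    rw [Function.iterate_succ_apply']
    set s := (step G ρ)^[k] (init r)
    obtain ⟨hsub, hpot⟩ := ih
    refine ⟨stack_subset_visited_step hsub, ?_⟩
    rcases hs : s.stack with _ | ⟨v, rest⟩
    · rw [step_nil hs]; exact Or.inl hs
    · right
      have hpot := hpot.resolve_left (by simp [hs])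
      rw [hs, List.length_cons] at hpot
      by_cases hw : ∃ w, G.Adj v w ∧ w ∉ s.visited
      · obtain ⟨w, hw', _, _, h1, h2, _⟩ := step_push (ρ := ρ) hs hw (hsub (by simp [hs]))
        rw [h1, h2]
        have e : {x | x ∉ s.visited} = insert w {x | x ∉ w :: s.visited} := by
          ext x
          by_cases hx : x = w
          · simp [hx, hw']
          · simp [hx]
        rw [e, Set.ncard_insert_of_notMem (by simp)] at hpot
        simp only [List.length_cons]
        omega
      · rw [step_pop hs hw]
        simp only
        omega

theorem final_stack (r : V) : (final G ρ r).stack = [] := by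
  rcases (stack_eq_nil_or_potential_le (G := G) (ρ := ρ) r (2 * Fintype.card V)).2 with h | h
  · exact h
  · omega

end Termination

/-! ### From the greedy walk to the broomstick. -/

section Stick

variable {V : Type*} {G : SimpleGraph V} {ρ : Rule V} {r : V}

/-- The vertex that the greedy walk reaches in `d` steps. -/
noncomputable def walkEnd (G : SimpleGraph V) (ρ : Rule V) (r : V) (d : ℕ) : V :=
  (walk G ρ r d).headD r

theorem walk_succ_eq (d : ℕ) : walk G ρ r (d + 1) = walkEnd G ρ r (d + 1) :: walk G ρ r d := rfl

theorem mem_walk {d : ℕ} {v : V} : v ∈ walk G ρ r d ↔ ∃ j ≤ d, v = walkEnd G ρ r j := by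
  induction d with
  | zero => simp [walk, walkEnd]
  | succ d ih =>
    rw [walk_succ_eq, List.mem_cons, ih]
    constructor
    · rintro (h | ⟨j, hj, h⟩)
      · exact ⟨_, le_rfl, h⟩
      · exact ⟨j, by omega, h⟩
    · rintro ⟨j, hj, h⟩
      rcases hj.eq_or_lt with rfl | hj
      · exact Or.inl h
      · exact Or.inr ⟨j, by omega, h⟩

theorem walkEnd_injOn [Fintype V] {i j : ℕ} (hij : i < j) (hj : j < Fintype.card V) :
    walkEnd G ρ r i ≠ walkEnd G ρ r j := by
  obtain ⟨j, rfl⟩ : ∃ k, j = k + 1 := ⟨j - 1, by omega⟩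
  have h := nodup_walk (G := G) (ρ := ρ) (r := r) hj
  rw [walk_succ_eq, List.nodup_cons, mem_walk] at h
  exact fun e ↦ h.1 ⟨i, by omega, e.symm⟩

/-- As long as the greedy walk meets no dead end, it is the depth-first search. -/
theorem iterate_step_eq_walk [Fintype V] {d : ℕ} (hd : d < Fintype.card V)
    (hA : ∀ e < d, ∃ w, G.Adj (walkEnd G ρ r e) w ∧ w ∉ walk G ρ r e) :
    ((step G ρ)^[d] (init r)).stack = walk G ρ r d ∧
    ((step G ρ)^[d] (init r)).visited = walk G ρ r d ∧
    ∀ x y, ((step G ρ)^[d] (init r)).parent x = some y ↔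
      ∃ j < d, y = walkEnd G ρ r j ∧ x = walkEnd G ρ r (j + 1) := by
  induction d with
  | zero => simp [init, walk]
  | succ d ih =>
    obtain ⟨h1, h2, h3⟩ := ih (by omega) fun e he ↦ hA e (by omega)
    rw [Function.iterate_succ_apply']
    set s := (step G ρ)^[d] (init r)
    have hs : s.stack = walkEnd G ρ r d :: (walk G ρ r d).tail := h1.trans (walk_eq_cons G ρ r d)
    have hw := hA d (by omega)
    obtain ⟨w, hw1, _, hweq, h4, h5, h6⟩ := step_push (G := G) (ρ := ρ) hs (by rwa [h2])
      (by rw [h2]; exact headD_mem_walk G ρ r d)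
    have hwe : w = walkEnd G ρ r (d + 1) := by
      rw [hweq, h2]
      change _ = nextVertex G ρ r (walk G ρ r d)
      exact (if_pos hw).symm
    refine ⟨?_, ?_, ?_⟩
    · rw [h4, ← hs, h1, hwe]; rfl
    · rw [h5, h2, hwe]; rfl
    · intro x y
      rw [h6, h3]
      constructor
      · rintro (⟨hx, hy⟩ | ⟨_, j, hj, h⟩)
        · exact ⟨d, by omega, hy, hx.trans hwe⟩
        · exact ⟨j, by omega, h⟩
      · rintro ⟨j, hj, hy, hx⟩
        rcases (Nat.lt_succ_iff.1 hj).eq_or_lt with rfl | hj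
        · exact Or.inl ⟨hx.trans hwe.symm, hy⟩
        · refine Or.inr ⟨?_, j, hj, hy, hx⟩
          rw [hwe, hx]
          exact walkEnd_injOn (by omega) hd

/-- The state of a search that has walked down to `x 0, …, x L` and has since then visited some of
the other vertices, always from a branch below `x L`. -/
structure BelowStick (G : SimpleGraph V) (ρ : Rule V) (r : V) (L : ℕ) (s : State V) : Prop where
  parent_stick : ∀ j ≤ L, ∀ w, s.parent w = some (walkEnd G ρ r j) ↔ w = walkEnd G ρ r (j + 1)
  parent_visited : ∀ v ∈ s.visited, v ≠ r → ∃ u, s.parent v = some u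
  closed : ∀ v ∈ s.visited, v ∉ s.stack → ∀ u, G.Adj v u → u ∈ s.visited
  stack_subset : s.stack ⊆ s.visited
  walk_subset : walk G ρ r (L + 1) ⊆ s.visited
  branch : (∃ v pre, s.stack = v :: (pre ++ walk G ρ r L) ∧ ∀ x ∈ v :: pre, x ∉ walk G ρ r L) ∨
    ∀ v, v ∈ s.visited

/-- The only danger is backtracking to `walkEnd G ρ r L` too early, and the connectivity hypothesis
`hB` excludes it. -/
theorem BelowStick.step {L : ℕ} {s : State V} (hx : walkEnd G ρ r (L + 1) ∉ walk G ρ r L)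
    (hB : ∀ T : Set V, (∀ v ∈ T, v ∉ walk G ρ r L) → T.Nonempty → (∃ b, b ∉ T ∧ b ∉ walk G ρ r L) →
      ∃ a ∈ T, ∃ b, b ∉ T ∧ b ∉ walk G ρ r L ∧ G.Adj a b)
    (h : BelowStick G ρ r L s) : BelowStick G ρ r L (step G ρ s) := by
  rcases hs : s.stack with _ | ⟨v, rest⟩
  · rwa [step_nil hs]
  by_cases hw : ∃ w, G.Adj v w ∧ w ∉ s.visited
  · have hv := h.stack_subset (by simp [hs] : v ∈ s.stack)
    obtain ⟨w, hw1, _, _, h4, h5, h6⟩ := step_push (ρ := ρ) hs hw hv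
    have hbr := h.branch.resolve_right fun hall ↦ hw1 (hall w)
    obtain ⟨v', pre, hst, hpre⟩ := hbr
    obtain ⟨rfl, hrest⟩ : v = v' ∧ rest = pre ++ walk G ρ r L := by
      rw [hs] at hst; exact List.cons.inj hst
    have hwL : w ∉ walk G ρ r (L + 1) := fun hm ↦ hw1 (h.walk_subset hm)
    refine ⟨?_, ?_, ?_, stack_subset_visited_step h.stack_subset, ?_, ?_⟩
    · intro j hj x
      rw [h6, h.parent_stick j hj]
      constructor
      · rintro (⟨_, hv⟩ | ⟨_, hx⟩)
        · exact absurd (mem_walk.2 ⟨j, hj, hv.symm⟩) (hpre v (by simp))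
        · exact hx
      · rintro rfl
        refine Or.inr ⟨?_, rfl⟩
        rintro rfl
        exact hwL (mem_walk.2 ⟨j + 1, by omega, rfl⟩)
    · intro x hx hxr
      rw [h5, List.mem_cons] at hx
      by_cases hxw : x = w
      · exact ⟨v, (h6 x v).2 (Or.inl ⟨hxw, rfl⟩)⟩
      · obtain ⟨u, hu⟩ := h.parent_visited x (hx.resolve_left hxw) hxr
        exact ⟨u, (h6 x u).2 (Or.inr ⟨hxw, hu⟩)⟩
    · intro x hx hxs u hu
      rw [h5, List.mem_cons] at hx ⊢
      rw [h4, List.mem_cons, ← hs, not_or] at hxs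
      exact Or.inr (h.closed x (hx.resolve_left hxs.1) hxs.2 u hu)
    · rw [h5]
      exact fun x hx ↦ List.mem_cons_of_mem _ (h.walk_subset hx)
    · refine Or.inl ⟨w, v :: pre, ?_, ?_⟩
      · rw [h4, hrest]; rfl
      · intro x hx
        rcases List.mem_cons.1 hx with rfl | hx
        · exact fun hm ↦ hwL (walk_subset_walk G ρ r (Nat.le_succ L) hm)
        · exact hpre x hx
  · rw [step_pop hs hw]
    push Not at hw
    have hclosed : ∀ x ∈ s.visited, x ∉ rest → ∀ u, G.Adj x u → u ∈ s.visited := by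
      intro x hx hxr u hu
      by_cases hxv : x = v
      · exact hw u (hxv ▸ hu)
      · exact h.closed x hx (by simp [hs, hxv, hxr]) u hu
    refine ⟨h.parent_stick, h.parent_visited, hclosed,
      fun x hx ↦ h.stack_subset (by rw [hs]; exact List.mem_cons_of_mem _ hx), h.walk_subset, ?_⟩
    rcases h.branch with ⟨v', pre, hst, hpre⟩ | hall
    · obtain ⟨rfl, hrest⟩ : v = v' ∧ rest = pre ++ walk G ρ r L := by
        rw [hs] at hst; exact List.cons.inj hst
      rcases pre with _ | ⟨v₂, pre⟩
      -- The pop uncovers the stick, so every visited vertex off the stick has left the stack and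
      -- has only visited neighbours. An unvisited vertex would then contradict `hB`.
      · right
        by_contra! hno
        obtain ⟨b, hb⟩ := hno
        have hsub := walk_subset_walk G ρ r (Nat.le_succ L)
        obtain ⟨a, ha, c, hc, hcL, hac⟩ := hB {x | x ∈ s.visited ∧ x ∉ walk G ρ r L}
          (fun x hx ↦ hx.2)
          ⟨walkEnd G ρ r (L + 1), h.walk_subset (mem_walk.2 ⟨_, le_rfl, rfl⟩), hx⟩
          ⟨b, fun hb' ↦ hb hb'.1, fun hb' ↦ hb (h.walk_subset (hsub hb'))⟩
        exact hc ⟨hclosed a ha.1 (by rw [hrest]; simpa using ha.2) c hac, hcL⟩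
      · exact Or.inl ⟨v₂, pre, hrest, fun x hx ↦ hpre x (List.mem_cons_of_mem _ hx)⟩
    · exact Or.inr hall

/-- If the first `L + 1` steps of the greedy walk meet no dead end, and the vertices other than the
first `L + 1` ones induce a connected graph, then the search tree is a broomstick. -/
theorem isBroomstick_of_walk [Fintype V] {L : ℕ} (hL : L + 1 < Fintype.card V)
    (hA : ∀ d ≤ L, ∃ w, G.Adj (walkEnd G ρ r d) w ∧ w ∉ walk G ρ r d)
    (hB : ∀ T : Set V, (∀ v ∈ T, v ∉ walk G ρ r L) → T.Nonempty → (∃ b, b ∉ T ∧ b ∉ walk G ρ r L) →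
      ∃ a ∈ T, ∃ b, b ∉ T ∧ b ∉ walk G ρ r L ∧ G.Adj a b)
    {ℓ b : ℝ} (hℓ : ℓ ≤ L) (hb : ((Fintype.card V - (L + 1) : ℕ) : ℝ) ≤ b) :
    IsBroomstick G ρ r ℓ b := by
  have hnd := nodup_walk (G := G) (ρ := ρ) (r := r) hL
  rw [walk_succ_eq, List.nodup_cons] at hnd
  obtain ⟨h1, h2, h3⟩ := iterate_step_eq_walk (G := G) (ρ := ρ) (r := r) hL
    fun e he ↦ hA e (by omega)
  have hstart : BelowStick G ρ r L ((step G ρ)^[L + 1] (init r)) := by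
    refine ⟨?_, ?_, ?_, ?_, ?_, Or.inl ⟨walkEnd G ρ r (L + 1), [], h1, ?_⟩⟩
    · intro j hj w
      rw [h3]
      constructor
      · rintro ⟨k, hk, hjk, hw⟩
        rcases lt_trichotomy j k with hlt | rfl | hlt
        · exact absurd hjk (walkEnd_injOn hlt (by omega))
        · exact hw
        · exact absurd hjk.symm (walkEnd_injOn hlt (by omega))
      · exact fun hw ↦ ⟨j, by omega, rfl, hw⟩
    · intro v hv hvr
      rw [h2, mem_walk] at hv
      obtain ⟨j, hj, rfl⟩ := hv
      rcases j with _ | j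
      · exact absurd rfl hvr
      · exact ⟨walkEnd G ρ r j, (h3 _ _).2 ⟨j, by omega, rfl, rfl⟩⟩
    · intro v hv hvs
      rw [h1] at hvs; rw [h2] at hv
      exact absurd hv hvs
    · rw [h1, h2]; exact fun x hx ↦ hx
    · rw [h2]; exact fun x hx ↦ hx
    · intro x hx
      rw [List.mem_singleton] at hx
      exact hx ▸ hnd.1
  have hiter : ∀ k, BelowStick G ρ r L ((step G ρ)^[k + (L + 1)] (init r)) := by
    intro k
    induction k with
    | zero => simpa using hstart
    | succ k ih =>
      rw [show k + 1 + (L + 1) = (k + (L + 1)) + 1 by ring, Function.iterate_succ_apply']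
      exact ih.step hnd.1 hB
  have hfinal : BelowStick G ρ r L (final G ρ r) := by
    have := hiter (2 * Fintype.card V - (L + 1))
    rwa [Nat.sub_add_cancel (by omega)] at this
  -- The final stack is empty, which leaves only the second alternative of `branch`.
  have hall : ∀ v, v ∈ (final G ρ r).visited := by
    refine hfinal.branch.resolve_left ?_
    rintro ⟨v, pre, h, _⟩
    simp [final_stack] at h
  refine ⟨fun v hv ↦ hfinal.parent_visited v (hall v) hv, L, fun j ↦ walkEnd G ρ r j,
    ⟨rfl, ?_, ?_⟩, hℓ, ?_⟩
  · intro j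
    exact (hfinal.parent_stick j (by omega) _).2 rfl
  · intro j
    refine ⟨walkEnd G ρ r (j + 1), (hfinal.parent_stick j (by omega) _).2 rfl, fun w hw ↦ ?_⟩
    exact (hfinal.parent_stick j (by omega) w).1 hw
  · refine le_of_eq_of_le ?_ hb
    have hinj : Function.Injective fun j : Fin (L + 1) ↦ walkEnd G ρ r j := by
      intro i j hij
      by_contra hne
      rcases lt_or_gt_of_ne (Fin.val_ne_of_ne hne) with h | h
      · exact walkEnd_injOn h (by omega) hij
      · exact walkEnd_injOn h (by omega) hij.symm
    have hc := Set.ncard_add_ncard_compl (Set.range fun j : Fin (L + 1) ↦ walkEnd G ρ r j)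
    rw [Nat.card_eq_fintype_card, Set.ncard_range_of_injective hinj, Nat.card_eq_fintype_card,
      Fintype.card_fin] at hc
    congr 1
    omega

end Stick

end DFS

/-! ### Numerical estimates. -/

section Estimates

theorem density_estimates {n m w : ℕ} {x : ℝ} (hn : 8 ≤ n) (hx : 1 ≤ x)
    (hm : m = ⌊x * n * Real.log n⌋₊) (hmN : m ≤ n.choose 2) (hw : w = ⌊(n : ℝ) / x⌋₊ - 1) :
    2 ≤ w ∧ w + 1 ≤ n ∧ (w : ℝ) + 1 ≤ n / x ∧
      Real.exp (-((m : ℝ) / n.choose 2 * (w - 1))) ≤ Real.exp 4 / n ^ 2 ∧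
      Real.exp (-((m : ℝ) / n.choose 2 * ((w - 2) / 2))) ≤ Real.exp 3 / n := by
  have hn' : (8 : ℝ) ≤ n := by exact_mod_cast hn
  have hn0 : (0 : ℝ) < n := by linarith
  have hx0 : 0 < x := by linarith
  have hl : 2 < Real.log n := by
    have h1 : Real.log 8 ≤ Real.log n := Real.log_le_log (by norm_num) hn'
    have h2 : Real.log 8 = 3 * Real.log 2 := by
      rw [show (8 : ℝ) = 2 ^ 3 by norm_num, Real.log_pow]; norm_num
    have := Real.log_two_gt_d9
    linarith
  have hexp : Real.exp (Real.log n) = n := Real.exp_log hn0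
  set l := Real.log n
  have hN : ((n.choose 2 : ℕ) : ℝ) = n * (n - 1) / 2 := Nat.cast_choose_two ℝ n
  have hmlt : x * n * l < m + 1 := by rw [hm]; exact Nat.lt_floor_add_one _
  have hmle : (m : ℝ) ≤ n * (n - 1) / 2 := by rw [← hN]; exact_mod_cast hmN
  -- The density `q` is about `2 * a`, and `a * y = l` for `y = n / x`. The bound `m ≤ n.choose 2`
  -- forces `a < 1 / 2`, hence `y > 4`.
  obtain ⟨a, ha⟩ : ∃ a, a = x * l / n := ⟨_, rfl⟩
  have hxl : x * l = a * n := by rw [ha]; field_simp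
  have ha0 : 0 < a := by rw [ha]; positivity
  have ha1 : a < 1 / 2 := by
    have h1 : a * n * n < n * (n - 1) / 2 + 1 := by nlinarith
    by_contra! h
    have : 1 / 2 * ((n : ℝ) * n) ≤ a * (n * n) := by gcongr
    nlinarith
  obtain ⟨y, hy⟩ : ∃ y, y = (n : ℝ) / x := ⟨_, rfl⟩
  have hay : a * y = l := by rw [ha, hy]; field_simp
  have hy4 : 4 < y := by nlinarith
  have hyn : y ≤ n := by rw [hy]; exact div_le_self hn0.le hx
  rw [← hy] at hw ⊢
  have hfl : 4 ≤ ⌊y⌋₊ := Nat.le_floor (by exact_mod_cast hy4.le)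
  have hfle : (⌊y⌋₊ : ℝ) ≤ y := Nat.floor_le (by linarith)
  have hflt : y < ⌊y⌋₊ + 1 := Nat.lt_floor_add_one y
  have hwf : (w : ℝ) + 1 = ⌊y⌋₊ := by exact_mod_cast (by omega : w + 1 = ⌊y⌋₊)
  have hw2 : 2 ≤ w := by omega
  have hw2' : (2 : ℝ) ≤ w := by exact_mod_cast hw2
  have hwn : (w : ℝ) + 1 ≤ n := by linarith
  obtain ⟨q, hq⟩ : ∃ q, q = (m : ℝ) / n.choose 2 := ⟨_, rfl⟩
  -- The subtracted term is the loss from the floor in `m`.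
  have hqa : 2 * a - 2 / (n * (n - 1)) ≤ q := by
    have hpos : (0 : ℝ) < n * (n - 1) := by nlinarith
    rw [hq, hN, sub_le_iff_le_add]
    have : (m : ℝ) / (n * (n - 1) / 2) + 2 / (n * (n - 1)) = 2 * (m + 1) / (n * (n - 1)) := by
      field_simp
    rw [this, le_div_iff₀ hpos]
    nlinarith [mul_pos ha0 hn0]
  have hsmall : ∀ z : ℝ, 0 ≤ z → z ≤ n - 1 → 2 * a * z - 1 / 4 ≤ q * z := by
    intro z hz hzn
    have h1 : 2 / ((n : ℝ) * (n - 1)) * z ≤ 1 / 4 := by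
      rw [div_mul_eq_mul_div, div_le_iff₀ (by nlinarith)]
      nlinarith
    nlinarith [mul_le_mul_of_nonneg_right hqa hz]
  rw [← hq]
  refine ⟨hw2, by exact_mod_cast hwn, by linarith, ?_, ?_⟩
  · have h := hsmall (w - 1) (by linarith) (by linarith)
    have h2 : a * (y - 3) ≤ a * (w - 1) :=
      mul_le_mul_of_nonneg_left (by linarith) ha0.le
    rw [← hexp, ← Real.exp_nat_mul, ← Real.exp_sub]
    apply Real.exp_le_exp.2
    push_cast
    linarith [show a * (y - 3) = l - 3 * a by rw [mul_sub, hay]; ring]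
  · have h := hsmall (w - 2) (by linarith) (by linarith)
    have h2 : a * (y - 4) ≤ a * (w - 2) :=
      mul_le_mul_of_nonneg_left (by linarith) ha0.le
    rw [← hexp, ← Real.exp_sub]
    apply Real.exp_le_exp.2
    linarith [show a * (y - 4) = l - 4 * a by rw [mul_sub, hay]; ring]

/-- By concavity `s * (w - s)` lies above its chord from `s = 1` to `s = w / 2`, so a cut of size
`s` costs at most `α * β ^ (s - 1)`. Then `w.choose s ≤ w * (w - 1).choose (s - 1)` reduces the sum
to `w * α * (1 + β) ^ (w - 1)`. -/
theorem sum_cuts_le {w : ℕ} (hw : 2 ≤ w) {q α β : ℝ} (hq : 0 ≤ q)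
    (hα : Real.exp (-(q * (w - 1))) ≤ α) (hβ : Real.exp (-(q * ((w - 2) / 2))) ≤ β) :
    ∑ S : Finset (Fin w) with S.Nonempty ∧ 2 * S.card ≤ w,
      Real.exp (-(q * (S.card * (w - S.card) : ℕ))) ≤ w * α * Real.exp (β * w) := by
  have hα0 : 0 ≤ α := (Real.exp_pos _).le.trans hα
  have hβ0 : 0 ≤ β := (Real.exp_pos _).le.trans hβ
  let f : ℕ → ℝ := fun s ↦ if s = 0 then 0 else α * β ^ (s - 1)
  have hf0 : ∀ s, 0 ≤ f s := fun s ↦ by simp only [f]; split_ifs <;> positivity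
  have hterm : ∀ S : Finset (Fin w), S.Nonempty ∧ 2 * S.card ≤ w →
      Real.exp (-(q * (S.card * (w - S.card) : ℕ))) ≤ f S.card := by
    rintro S ⟨hne, h2⟩
    obtain ⟨t, ht⟩ : ∃ t, S.card = t + 1 := ⟨S.card - 1, by have := hne.card_pos; omega⟩
    have h2' : 2 * ((t : ℝ) + 1) ≤ w := by rw [ht] at h2; exact_mod_cast h2
    simp only [f, ht, Nat.add_sub_cancel]
    rw [if_neg (by omega)]
    calc Real.exp (-(q * ((t + 1) * (w - (t + 1)) : ℕ)))
        ≤ Real.exp (-(q * (w - 1)) + t * -(q * ((w - 2) / 2))) := by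
          apply Real.exp_le_exp.2
          rw [Nat.cast_mul, Nat.cast_sub (by omega)]
          push_cast
          have : (w - 1 : ℝ) + t * ((w - 2) / 2) ≤ (t + 1) * (w - (t + 1)) := by
            nlinarith [mul_nonneg (Nat.cast_nonneg (α := ℝ) t) (sub_nonneg.2 h2')]
          nlinarith [mul_le_mul_of_nonneg_left this hq]
      _ = Real.exp (-(q * (w - 1))) * Real.exp (-(q * ((w - 2) / 2))) ^ t := by
          rw [Real.exp_add, Real.exp_nat_mul]
      _ ≤ α * β ^ t := by gcongr
  obtain ⟨v, rfl⟩ : ∃ v, w = v + 1 := ⟨w - 1, by omega⟩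
  calc _ ≤ ∑ S : Finset (Fin (v + 1)) with S.Nonempty ∧ 2 * S.card ≤ v + 1, f S.card :=
        Finset.sum_le_sum fun S hS ↦ hterm S (Finset.mem_filter.1 hS).2
    _ ≤ ∑ S : Finset (Fin (v + 1)), f S.card :=
        Finset.sum_le_sum_of_subset_of_nonneg (Finset.filter_subset _ _) fun S _ _ ↦ hf0 _
    _ = ∑ s ∈ Finset.range (v + 1 + 1), ((v + 1).choose s) • f s := by
        have := Finset.sum_powerset_apply_card f (x := (Finset.univ : Finset (Fin (v + 1))))
        simpa using this
    _ = ∑ t ∈ Finset.range (v + 1), ((v + 1).choose (t + 1) : ℝ) * (α * β ^ t) := by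
        rw [Finset.sum_range_succ']
        simp [f]
    _ ≤ ∑ t ∈ Finset.range (v + 1), ((v + 1 : ℕ) : ℝ) * α * (β ^ t * 1 ^ (v - t) * v.choose t) := by
        refine Finset.sum_le_sum fun t _ ↦ ?_
        have h : (v + 1).choose (t + 1) ≤ (v + 1) * v.choose t := by
          rw [Nat.add_one_mul_choose_eq]
          exact Nat.le_mul_of_pos_right _ (by omega)
        have h' : ((v + 1).choose (t + 1) : ℝ) ≤ ((v + 1 : ℕ) : ℝ) * v.choose t := by
          exact_mod_cast h
        calc _ ≤ ((v + 1 : ℕ) : ℝ) * v.choose t * (α * β ^ t) := by gcongr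
          _ = _ := by ring
    _ = ((v + 1 : ℕ) : ℝ) * α * (β + 1) ^ v := by rw [← Finset.mul_sum, add_pow]
    _ ≤ _ := by
        have h1 : β + 1 ≤ Real.exp β := Real.add_one_le_exp β
        have h2 : (β + 1) ^ v ≤ Real.exp β ^ v := by gcongr
        rw [← Real.exp_nat_mul] at h2
        gcongr
        refine h2.trans (Real.exp_le_exp.2 ?_)
        push_cast
        nlinarith

end Estimates

/-! ### Probabilities in `gnm` from counts. -/

section Gnm

open Classical in
theorem card_graphs_ge (n m : ℕ) :
    (n.choose 2).choose m ≤
      (Finset.univ.filter fun G : SimpleGraph (Fin n) ↦ G.edgeSet.ncard = m).card := by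
  have hΩ : (⊤ : SimpleGraph (Fin n)).edgeFinset.card = n.choose 2 := by
    rw [SimpleGraph.card_edgeFinset_top_eq_card_choose_two, Fintype.card_fin]
  rw [← hΩ, ← Finset.card_powersetCard]
  have hset : ∀ A ∈ (⊤ : SimpleGraph (Fin n)).edgeFinset.powersetCard m,
      (SimpleGraph.fromEdgeSet (A : Set (Sym2 (Fin n)))).edgeSet = A := by
    intro A hA
    rw [SimpleGraph.edgeSet_fromEdgeSet, sdiff_eq_left, Set.disjoint_left]
    intro e he
    have := (Finset.mem_powersetCard.1 hA).1 he
    rw [SimpleGraph.mem_edgeFinset] at this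
    exact SimpleGraph.not_isDiag_of_mem_edgeSet _ this
  refine Finset.card_le_card_of_injOn
    (fun A ↦ SimpleGraph.fromEdgeSet (A : Set (Sym2 (Fin n)))) ?_ ?_
  · intro A hA
    rw [Finset.mem_coe] at hA
    simp only [Finset.coe_filter, Finset.mem_univ, true_and, Set.mem_ofPred_eq]
    rw [hset A hA, Set.ncard_coe_finset, (Finset.mem_powersetCard.1 hA).2]
  · intro A hA B hB h
    have := congrArg SimpleGraph.edgeSet h
    simp only at this
    rwa [hset A hA, hset B hB, Finset.coe_inj] at this

theorem gnm_isProbabilityMeasure {n m : ℕ} (hm : m ≤ n.choose 2) :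
    IsProbabilityMeasure (gnm n m) := by
  classical
  refine isProbabilityMeasure_uniformOn (Set.toFinite _) ?_
  have h := (Nat.choose_pos hm).trans_le (card_graphs_ge n m)
  obtain ⟨G, hG⟩ := Finset.card_pos.1 h
  exact ⟨G, (Finset.mem_filter.1 hG).2⟩

open Classical in
theorem gnm_real_le {n m k : ℕ} (hm : m ≤ n.choose 2) (E : Set (SimpleGraph (Fin n)))
    (hE : (Finset.univ.filter fun G : SimpleGraph (Fin n) ↦ G.edgeSet.ncard = m ∧ G ∈ E).card ≤
      (n.choose 2 - k).choose m) :
    (gnm n m).real E ≤ Real.exp (-((m : ℝ) / n.choose 2 * k)) := by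
  have h := uniformOn_apply_finset
    (s := Finset.univ.filter fun G : SimpleGraph (Fin n) ↦ G.edgeSet.ncard = m)
    (t := Finset.univ.filter fun G : SimpleGraph (Fin n) ↦ G ∈ E)
  rw [← Finset.filter_and] at h
  simp only [Finset.coe_filter, Finset.mem_univ, true_and, Set.ofPred_mem_eq] at h
  rw [measureReal_def, gnm, h, ENNReal.toReal_div, ENNReal.toReal_natCast, ENNReal.toReal_natCast]
  have hpos : (0 : ℝ) < (n.choose 2).choose m := by exact_mod_cast Nat.choose_pos hm
  have hge : ((n.choose 2).choose m : ℝ) ≤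
    (Finset.univ.filter fun G : SimpleGraph (Fin n) ↦ G.edgeSet.ncard = m).card := by
    exact_mod_cast card_graphs_ge n m
  rw [div_le_iff₀ (hpos.trans_le hge)]
  calc _ ≤ ((n.choose 2 - k).choose m : ℝ) := by exact_mod_cast hE
    _ ≤ _ := choose_sub_le_exp_mul_choose _ _ _
    _ ≤ _ := by gcongr

end Gnm

/-! ### The two kinds of failure and their probabilities. -/

namespace DFS

variable {n : ℕ}

/-- The graphs for which the greedy walk meets a dead end after `d` steps. -/
def deadEnd (ρ : Rule (Fin n)) (r : Fin n) (d : ℕ) : Set (SimpleGraph (Fin n)) :=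
  {G | ∀ w, w ∉ walk G ρ r d → ¬ G.Adj (walkEnd G ρ r d) w}

/-- The graphs in which no edge joins the vertices labelled by `S` to the other labelled ones, the
labelling being `lab l`, where `l` is the list of the vertices visited by the first `d` steps of
the greedy walk. -/
def emptyCut (ρ : Rule (Fin n)) (r : Fin n) (d : ℕ) {w : ℕ} (lab : List (Fin n) → Fin w → Fin n)
    (S : Finset (Fin w)) : Set (SimpleGraph (Fin n)) :=
  {G | ∀ i ∈ S, ∀ j ∉ S, ¬ G.Adj (lab (walk G ρ r d) i) (lab (walk G ρ r d) j)}

theorem gnm_real_deadEnd_le {m d : ℕ} (hm : m ≤ n.choose 2) (hd : d < n) (ρ : Rule (Fin n))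
    (r : Fin n) :
    (gnm n m).real (deadEnd ρ r d) ≤
      Real.exp (-((m : ℝ) / n.choose 2 * (n - (d + 1) : ℕ))) := by
  classical
  apply gnm_real_le hm
  have h := card_no_cut_edge_le ρ r d m 1 (n - (d + 1)) (by simpa using hd)
    -- The walk has not yet used the edges from its latest vertex to the unvisited ones.
    (fun l ↦ {l.headD r}) (fun l ↦ l.toFinsetᶜ) ?_
  · rw [Fintype.card_fin, one_mul] at h
    convert h using 4
    simp [deadEnd, walkEnd]
  · intro l hne hnd hlen
    obtain ⟨v, t, rfl⟩ := List.exists_cons_of_ne_nil hne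
    refine ⟨by simp, by simp, ?_, ?_⟩
    · rw [Finset.card_compl, List.toFinset_card_of_nodup hnd, hlen, Fintype.card_fin]
    · intro x hx
      have hv := (List.nodup_cons.1 hnd).1
      simp only [List.tail_cons] at hx
      simp only [List.headD_cons, Finset.mem_singleton, Finset.mem_compl, List.mem_toFinset,
        List.mem_cons, hx, or_true, not_true, not_false_iff, and_true]
      rintro rfl
      exact hv hx

theorem gnm_real_emptyCut_le {m d w : ℕ} (hm : m ≤ n.choose 2) (hd : d < n) (ρ : Rule (Fin n))
    (r : Fin n) (lab : List (Fin n) → Fin w → Fin n)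
    (hlab : ∀ l, l.Nodup → l.length = d + 1 → Function.Injective (lab l) ∧ ∀ i, lab l i ∉ l)
    (S : Finset (Fin w)) :
    (gnm n m).real (emptyCut ρ r d lab S) ≤
      Real.exp (-((m : ℝ) / n.choose 2 * (S.card * (w - S.card) : ℕ))) := by
  classical
  apply gnm_real_le hm
  have h := card_no_cut_edge_le ρ r d m S.card (w - S.card) (by simpa using hd)
    (fun l ↦ S.image (lab l)) (fun l ↦ Sᶜ.image (lab l)) ?_
  · rw [Fintype.card_fin] at h
    convert h using 4
    simp [emptyCut]
  · intro l hne hnd hlen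
    obtain ⟨hinj, hout⟩ := hlab l hnd hlen
    refine ⟨?_, Finset.card_image_of_injective _ hinj, ?_, ?_⟩
    · rw [Finset.disjoint_image hinj]
      exact disjoint_compl_right
    · rw [Finset.card_image_of_injective _ hinj, Finset.card_compl, Fintype.card_fin]
    · intro x hx
      have hxl := List.mem_of_mem_tail hx
      constructor <;>
      · rw [Finset.mem_image]
        rintro ⟨i, _, rfl⟩
        exact hout i hxl

/-- The unvisited set is random; labelling it by `Fin w` lets the union bound run over fixed index
sets `S`. -/
theorem exists_labelling {d w : ℕ} (hw : w + (d + 1) = n) :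
    ∃ lab : List (Fin n) → Fin w → Fin n, ∀ l, l.Nodup → l.length = d + 1 →
      Function.Injective (lab l) ∧ (∀ i, lab l i ∉ l) ∧ ∀ v ∉ l, ∃ i, lab l i = v := by
  classical
  have h : ∀ l : List (Fin n), ∃ g : Fin w → Fin n, l.Nodup → l.length = d + 1 →
      Function.Injective g ∧ (∀ i, g i ∉ l) ∧ ∀ v ∉ l, ∃ i, g i = v := by
    intro l
    by_cases hl : l.Nodup ∧ l.length = d + 1
    · have hc : (l.toFinsetᶜ).card = w := by
        rw [Finset.card_compl, List.toFinset_card_of_nodup hl.1, hl.2, Fintype.card_fin]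
        omega
      refine ⟨l.toFinsetᶜ.orderEmbOfFin hc, fun _ _ ↦
        ⟨(l.toFinsetᶜ.orderEmbOfFin hc).injective, fun i ↦ ?_, fun v hv ↦ ?_⟩⟩
      · have := l.toFinsetᶜ.orderEmbOfFin_mem hc i
        rwa [Finset.mem_compl, List.mem_toFinset] at this
      · have : v ∈ Set.range (l.toFinsetᶜ.orderEmbOfFin hc) := by
          rw [Finset.range_orderEmbOfFin]
          simpa using hv
        exact this
    · exact ⟨fun i ↦ ⟨i, by omega⟩, fun h1 h2 ↦ absurd ⟨h1, h2⟩ hl⟩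
  choose lab hlab using h
  exact ⟨lab, hlab⟩

/-- A graph whose greedy walk has no dead end in its first `L + 1` steps, and no empty cut in the
rest of the graph, has a broomstick as its search tree. -/
theorem isBroomstick_of_notMem {L w : ℕ} (hw : w + (L + 1) = n) (hw0 : 0 < w) {ρ : Rule (Fin n)}
    {r : Fin n} {lab : List (Fin n) → Fin w → Fin n}
    (hlab : ∀ l, l.Nodup → l.length = L + 1 →
      Function.Injective (lab l) ∧ (∀ i, lab l i ∉ l) ∧ ∀ v ∉ l, ∃ i, lab l i = v)
    {G : SimpleGraph (Fin n)} (hdead : ∀ d ≤ L, G ∉ deadEnd ρ r d)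
    (hcut : ∀ S : Finset (Fin w), S.Nonempty → 2 * S.card ≤ w → G ∉ emptyCut ρ r L lab S)
    {ℓ b : ℝ} (hℓ : ℓ ≤ L) (hb : (w : ℝ) ≤ b) : IsBroomstick G ρ r ℓ b := by
  classical
  have hcard : Fintype.card (Fin n) = n := Fintype.card_fin n
  refine isBroomstick_of_walk (by omega) ?_ ?_ hℓ ?_
  · intro d hd
    have := hdead d hd
    simp only [deadEnd, Set.mem_ofPred_eq, not_forall, not_not] at this
    obtain ⟨v, h1, h2⟩ := this
    exact ⟨v, h2, h1⟩
  · intro T hT hne hne'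
    obtain ⟨_, hout, hsurj⟩ := hlab (walk G ρ r L) (nodup_walk (by omega)) (length_walk G ρ r L)
    by_contra! hno
    let S : Finset (Fin w) := Finset.univ.filter fun i ↦ lab (walk G ρ r L) i ∈ T
    have hS : ∀ i, i ∈ S ↔ lab (walk G ρ r L) i ∈ T := fun i ↦ by simp [S]
    have hSno : ∀ i ∈ S, ∀ j ∉ S, ¬ G.Adj (lab (walk G ρ r L) i) (lab (walk G ρ r L) j) :=
      fun i hi j hj ↦ hno _ ((hS i).1 hi) _ (fun h ↦ hj ((hS j).2 h)) (hout j)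
    have hSc := Finset.card_compl S
    rw [Fintype.card_fin] at hSc
    -- An empty cut is symmetric, so the side with at most half of the vertices can be used.
    rcases le_or_gt (2 * S.card) w with h | h
    · obtain ⟨v, hv⟩ := hne
      obtain ⟨i, rfl⟩ := hsurj v (hT v hv)
      exact hcut S ⟨i, (hS i).2 hv⟩ h hSno
    · obtain ⟨v, hv, hv'⟩ := hne'
      obtain ⟨i, rfl⟩ := hsurj v hv'
      refine hcut Sᶜ ⟨i, by rw [Finset.mem_compl, hS]; exact hv⟩ (by omega) ?_
      intro a ha b hb hab
      rw [Finset.mem_compl] at ha hb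
      exact hSno b (not_not.1 hb) a ha hab.symm
  · rw [hcard, ← hw, Nat.add_sub_cancel]
    exact hb

end DFS

/-! ### The union bound. -/

theorem theorem1 :
    ∃ C : ℝ, ∀ (n m : ℕ) (i : ℝ), 0 ≤ i →
      m = ⌊(2 : ℝ) ^ i * (n : ℝ) * Real.log (n : ℝ)⌋₊ → m ≤ n.choose 2 →
      ∀ (ρ : DFS.Rule (Fin n)) (r : Fin n),
        1 - C / (n : ℝ) ≤
          (gnm n m).real
            {G | DFS.IsBroomstick G ρ r ((n : ℝ) - (n : ℝ) / 2 ^ i) ((n : ℝ) / 2 ^ i)} := by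
  -- The `8` makes the claim trivial for `n < 8`; the two products with `Real.exp 4` pay for the
  -- dead ends and for the cuts.
  refine ⟨8 + Real.exp 4 * (1 + Real.exp (Real.exp 3)), fun n m i hi hm hmN ρ r ↦ ?_⟩
  have hn0 : (0 : ℝ) < n := by exact_mod_cast r.pos
  rcases lt_or_ge n 8 with hn | hn
  · have : (n : ℝ) < 8 := by exact_mod_cast hn
    refine le_trans ?_ measureReal_nonneg
    rw [sub_nonpos, one_le_div hn0]
    have : 0 < Real.exp 4 * (1 + Real.exp (Real.exp 3)) := by positivity
    linarith
  have hx : (1 : ℝ) ≤ 2 ^ i := Real.one_le_rpow (by norm_num) hi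
  -- The `- 1` is needed because a stick with `n - w` vertices has only `n - w - 1` edges.
  obtain ⟨w, hw⟩ : ∃ w, w = ⌊(n : ℝ) / 2 ^ i⌋₊ - 1 := ⟨_, rfl⟩
  obtain ⟨hw2, hwn, hwx, hα, hβ⟩ := density_estimates hn hx hm hmN hw
  obtain ⟨L, hL⟩ : ∃ L, w + (L + 1) = n := ⟨n - (w + 1), by omega⟩
  have hwL : (w : ℝ) + (L + 1) = n := by exact_mod_cast hL
  obtain ⟨lab, hlab⟩ := DFS.exists_labelling hL
  have := gnm_isProbabilityMeasure hmN
  set μ := gnm n m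
  set q : ℝ := (m : ℝ) / n.choose 2
  have hq : 0 ≤ q := by positivity
  set E : Set (SimpleGraph (Fin n)) :=
    {G | DFS.IsBroomstick G ρ r ((n : ℝ) - (n : ℝ) / 2 ^ i) ((n : ℝ) / 2 ^ i)}
  let F : Finset (Finset (Fin w)) := Finset.univ.filter fun S ↦ S.Nonempty ∧ 2 * S.card ≤ w
  have hcover : (Set.univ : Set (SimpleGraph (Fin n))) ⊆
      E ∪ ((⋃ d ∈ Finset.range (L + 1), DFS.deadEnd ρ r d) ∪
        ⋃ S ∈ F, DFS.emptyCut ρ r L lab S) := by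
    intro G _
    by_contra hG
    simp only [Set.mem_union, Set.mem_iUnion, not_or, not_exists, Finset.mem_range] at hG
    obtain ⟨h1, h2, h3⟩ := hG
    refine h1 (DFS.isBroomstick_of_notMem hL (by omega) hlab (fun d hd ↦ h2 d (by omega))
      (fun S hS hS' ↦ h3 S (by simp [F, hS, hS'])) (by linarith) (by linarith))
  have hdead : μ.real (⋃ d ∈ Finset.range (L + 1), DFS.deadEnd ρ r d) ≤ Real.exp 4 / n := by
    refine (measureReal_biUnion_finset_le _ _).trans ?_
    have hterm : ∀ d ∈ Finset.range (L + 1),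
        μ.real (DFS.deadEnd ρ r d) ≤ Real.exp 4 / n ^ 2 := by
      intro d hd
      rw [Finset.mem_range] at hd
      refine (DFS.gnm_real_deadEnd_le hmN (by omega) ρ r).trans (le_trans ?_ hα)
      -- At least `w` vertices are unvisited, one more than `hα`, the bound for one-vertex cuts,
      -- requires.
      have : (w : ℝ) ≤ (n - (d + 1) : ℕ) := by exact_mod_cast (by omega : w ≤ n - (d + 1))
      gcongr
      linarith
    refine (Finset.sum_le_card_nsmul _ _ _ hterm).trans ?_
    rw [Finset.card_range, nsmul_eq_mul]
    calc ((L + 1 : ℕ) : ℝ) * (Real.exp 4 / n ^ 2) ≤ n * (Real.exp 4 / n ^ 2) := by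
          gcongr; omega
      _ = _ := by field_simp
  have hcut : μ.real (⋃ S ∈ F, DFS.emptyCut ρ r L lab S) ≤
      Real.exp 4 * Real.exp (Real.exp 3) / n := by
    refine (measureReal_biUnion_finset_le _ _).trans ?_
    refine (Finset.sum_le_sum fun S _ ↦ DFS.gnm_real_emptyCut_le hmN (by omega) ρ r lab
      (fun l h1 h2 ↦ ⟨(hlab l h1 h2).1, (hlab l h1 h2).2.1⟩) S).trans ?_
    refine (sum_cuts_le hw2 hq hα hβ).trans ?_
    have hwn' : (w : ℝ) ≤ n := by exact_mod_cast (by omega : w ≤ n)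
    calc (w : ℝ) * (Real.exp 4 / n ^ 2) * Real.exp (Real.exp 3 / n * w)
        ≤ n * (Real.exp 4 / n ^ 2) * Real.exp (Real.exp 3 / n * n) := by gcongr
      _ = _ := by
        rw [div_mul_cancel₀ _ hn0.ne']
        field_simp
  have h1 : (1 : ℝ) ≤ μ.real E + (Real.exp 4 / n + Real.exp 4 * Real.exp (Real.exp 3) / n) := by
    calc (1 : ℝ) = μ.real Set.univ := probReal_univ.symm
      _ ≤ _ := measureReal_mono hcover
      _ ≤ _ := measureReal_union_le _ _
      _ ≤ _ := by
        gcongr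
        exact (measureReal_union_le _ _).trans (add_le_add hdead hcut)
  have h8 : 0 ≤ 8 / (n : ℝ) := by positivity
  have hC : (8 + Real.exp 4 * (1 + Real.exp (Real.exp 3))) / (n : ℝ) =
      8 / n + (Real.exp 4 / n + Real.exp 4 * Real.exp (Real.exp 3) / n) := by ring
  rw [hC]
  linarith
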